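/- Let $n\in\mathbb N$, $0<s<1<p<\infty$. Let $W^{s,p}(\mathbb R^n)$ be the space of $u\in L^p(\mathbb R^n)$ with finite norm $$\|u\|_{s,p}=\Big(\int_{\mathbb R^n}|u|^p\,dx+\iint_{\mathbb R^n\times\mathbb R^n}\frac{|u(x)-u(y)|^p}{|x-y|^{n+sp}}\,dx\,dy\Big)^{1/p},$$ and for open $\Omega\subset\mathbb R^n$ let $W^{s,p}_0(\Omega)=\{u\in W^{s,p}(\mathbb R^n): u=0 \text{ a.e. in }\mathbb R^n\setminus\Omega\}$, with the norm $\|\cdot\|_{s,p}$. Let $D\subset\mathbb R^n$ be a bounded open set, let $f$ belong to the dual $W^{-s,p'}(D)=[W^{s,p}_0(D)]'$, and, for open $\Omega\subset D$, denote by $u_\Omega^f\in W^{s,p}_0(\Omega)$ the weak solution of $(-\Delta_p)^su=f$ in $\Omega$, $u=0$ in $\mathbb R^n\setminus\Omega$, that is, $$\iint_{\mathbb R^n\times\mathbb R^n}\frac{|u(x)-u(y)|^{p-2}(u(x)-u(y))(v(x)-v(y))}{|x-y|^{n+sp}}\,dx\,dy=\langle f,v\rangle\qquad\text{for every } v\in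 W^{s,p}_0(\Omega).$$ Let $\Omega_k$ ($k\in\mathbb N$) and $\Omega$ be open subsets of $D$ such that $\Omega_k\to\Omega$ in the Hausdorff complementary topology, i.e. the Hausdorff distance between the sets $\overline D\setminus\Omega_k$ and $\overline D\setminus\Omega$ tends to $0$. Assume that $u_{\Omega_k}^f\rightharpoonup u^*$ weakly in $W^{s,p}_0(D)$ for some $u^*\in W^{s,p}_0(D)$. Then $(-\Delta_p)^su^*=f$ in $\Omega$ in the sense of distributions: for every $\phi\in C_c^\infty(\Omega)$ one has $\phi\in W^{s,p}_0(D)$, the integral below converges absolutely, and $$\iint_{\mathbb R^n\times\mathbb R^n}\frac{|u^*(x)-u^*(y)|^{p-2}(u^*(x)-u^*(y))(\phi(x)-\phi(y))}{|x-y|^{n+sp}}\,dx\,dy=\langle f,\phi\rangle .$$ -/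

import Mathlib

open Filter Topology MeasureTheory
open scoped ENNReal ContDiff

namespace FracPLap

instance fact_one_le_ofReal {p : ℝ} [hp : Fact (1 < p)] : Fact (1 ≤ ENNReal.ofReal p) :=
  ⟨by simpa using ENNReal.ofReal_le_ofReal hp.out.le⟩

/-- The Hausdorff complementary distance of two subsets of a (compact) container `K`: the
Hausdorff distance of their complements in `K`, with values in `[0, ∞]`. -/
noncomputable def hausdorffComplEDist {n : ℕ} (K Ω₁ Ω₂ : Set (EuclideanSpace ℝ (Fin n))) : ℝ≥0∞ :=
  Metric.hausdorffEDist (K \ Ω₁) (K \ Ω₂)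

/-- The Gagliardo quotient `(u(x) - u(y)) / |x - y| ^ (n / p + s)`. -/
noncomputable def gagliardoQuot {n : ℕ} (s p : ℝ) (u : EuclideanSpace ℝ (Fin n) → ℝ) :
    EuclideanSpace ℝ (Fin n) × EuclideanSpace ℝ (Fin n) → ℝ :=
  fun z => (u z.1 - u z.2) / ‖z.1 - z.2‖ ^ ((n : ℝ) / p + s)

section Quot

variable {n : ℕ} {s p : ℝ}

theorem gagliardoQuot_congr {u v : EuclideanSpace ℝ (Fin n) → ℝ} (h : u =ᵐ[volume] v) :
    gagliardoQuot s p u =ᵐ[volume] gagliardoQuot s p v := by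
  have h1 := (Measure.quasiMeasurePreserving_fst
    (μ := (volume : Measure (EuclideanSpace ℝ (Fin n))))
    (ν := (volume : Measure (EuclideanSpace ℝ (Fin n))))).ae_eq_comp h
  have h2 := (Measure.quasiMeasurePreserving_snd
    (μ := (volume : Measure (EuclideanSpace ℝ (Fin n))))
    (ν := (volume : Measure (EuclideanSpace ℝ (Fin n))))).ae_eq_comp h
  filter_upwards [h1, h2] with z hz1 hz2
  simp only [Function.comp] at hz1 hz2
  simp only [gagliardoQuot, hz1, hz2]

theorem gagliardoQuot_add (u v : EuclideanSpace ℝ (Fin n) → ℝ) :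
    gagliardoQuot s p (u + v) = gagliardoQuot s p u + gagliardoQuot s p v := by
  funext z
  simp only [gagliardoQuot, Pi.add_apply]
  ring

theorem gagliardoQuot_smul (c : ℝ) (u : EuclideanSpace ℝ (Fin n) → ℝ) :
    gagliardoQuot s p (c • u) = c • gagliardoQuot s p u := by
  funext z
  simp only [gagliardoQuot, Pi.smul_apply, smul_eq_mul]
  ring

theorem gagliardoQuot_zero :
    gagliardoQuot s p (0 : EuclideanSpace ℝ (Fin n) → ℝ) = 0 := by
  funext z
  simp [gagliardoQuot]

end Quot

/-- The classes `u ∈ L^p(ℝⁿ)` whose Gagliardo quotient lies in `L^p(ℝⁿ × ℝⁿ)`. -/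
noncomputable def sobolevSubmodule (n : ℕ) (s p : ℝ) [Fact (1 < p)] :
    Submodule ℝ (Lp ℝ (ENNReal.ofReal p) (volume : Measure (EuclideanSpace ℝ (Fin n)))) where
  carrier := {u | MemLp (gagliardoQuot s p u) (ENNReal.ofReal p) volume}
  zero_mem' := by
    refine (memLp_congr_ae ?_).2 (MemLp.zero' (ε := ℝ))
    refine (gagliardoQuot_congr (Lp.coeFn_zero _ _ _)).trans ?_
    rw [gagliardoQuot_zero]
    rfl
  add_mem' := by
    intro u v hu hv
    refine (memLp_congr_ae ?_).2 (hu.add hv)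
    refine (gagliardoQuot_congr (Lp.coeFn_add u v)).trans ?_
    rw [gagliardoQuot_add]
  smul_mem' := by
    intro c u hu
    refine (memLp_congr_ae ?_).2 (hu.const_smul c)
    refine (gagliardoQuot_congr (Lp.coeFn_smul c u)).trans ?_
    rw [gagliardoQuot_smul]

/-- The fractional Sobolev space `W^{s,p}(ℝⁿ)`. Its norm is not the one of `L^p` but the full
`W^{s,p}` norm defined below. -/
def FracSobolev (n : ℕ) (s p : ℝ) [Fact (1 < p)] : Type := sobolevSubmodule n s p

namespace FracSobolev

variable {n : ℕ} {s p : ℝ} [Fact (1 < p)]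

noncomputable instance : AddCommGroup (FracSobolev n s p) :=
  inferInstanceAs (AddCommGroup (sobolevSubmodule n s p))

noncomputable instance : Module ℝ (FracSobolev n s p) :=
  inferInstanceAs (Module ℝ (sobolevSubmodule n s p))

/-- The underlying class in `L^p(ℝⁿ)`. -/
noncomputable def toLp :
    FracSobolev n s p →ₗ[ℝ] Lp ℝ (ENNReal.ofReal p) (volume : Measure (EuclideanSpace ℝ (Fin n))) :=
  (sobolevSubmodule n s p).subtype

theorem toLp_injective : Function.Injective (toLp (n := n) (s := s) (p := p)) :=
  Subtype.val_injective

theorem memLp_gagliardoQuot (u : FracSobolev n s p) :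
    MemLp (gagliardoQuot s p (toLp u)) (ENNReal.ofReal p) volume :=
  u.2

/-- The linear map sending `u` to the pair of `u` and its Gagliardo quotient, in the `ℓ^p` sum
of `L^p(ℝⁿ)` and `L^p(ℝⁿ × ℝⁿ)`. -/
noncomputable def toPair : FracSobolev n s p →ₗ[ℝ]
    WithLp (ENNReal.ofReal p)
      (Lp ℝ (ENNReal.ofReal p) (volume : Measure (EuclideanSpace ℝ (Fin n))) ×
        Lp ℝ (ENNReal.ofReal p)
          (volume : Measure (EuclideanSpace ℝ (Fin n) × EuclideanSpace ℝ (Fin n)))) where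
  toFun u := WithLp.toLp _ (toLp u, (memLp_gagliardoQuot u).toLp _)
  map_add' u v := by
    have h : (memLp_gagliardoQuot (u + v)).toLp _ =
        (memLp_gagliardoQuot u).toLp _ + (memLp_gagliardoQuot v).toLp _ := by
      rw [← MemLp.toLp_add, MemLp.toLp_eq_toLp_iff, ← gagliardoQuot_add, map_add]
      exact gagliardoQuot_congr (Lp.coeFn_add _ _)
    rw [h, map_add, ← WithLp.toLp_add]
    rfl
  map_smul' c u := by
    have h : (memLp_gagliardoQuot (c • u)).toLp _ = c • (memLp_gagliardoQuot u).toLp _ := by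
      rw [← MemLp.toLp_const_smul, MemLp.toLp_eq_toLp_iff, ← gagliardoQuot_smul, map_smul]
      exact gagliardoQuot_congr (Lp.coeFn_smul _ _)
    rw [h, map_smul, RingHom.id_apply, ← WithLp.toLp_smul]
    rfl

theorem toPair_injective : Function.Injective (toPair (n := n) (s := s) (p := p)) := by
  intro u v h
  exact toLp_injective (congrArg (fun w => w.fst) h)

/-- The norm `‖u‖ = (∫ |u|^p + ∬ |u(x) - u(y)|^p / |x - y|^(n + sp))^(1/p)`, as `norm_eq` shows. -/
noncomputable instance : NormedAddCommGroup (FracSobolev n s p) :=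
  NormedAddCommGroup.induced _ _ toPair toPair_injective

noncomputable instance : NormedSpace ℝ (FracSobolev n s p) :=
  NormedSpace.induced ℝ _ _ toPair

theorem norm_eq (u : FracSobolev n s p) :
    ‖u‖ = ((∫ x, |toLp u x| ^ p) +
      ∫ z : EuclideanSpace ℝ (Fin n) × EuclideanSpace ℝ (Fin n),
        |toLp u z.1 - toLp u z.2| ^ p / ‖z.1 - z.2‖ ^ ((n : ℝ) + s * p)) ^ (1 / p) := by
  have hp1 : 1 < p := Fact.out
  have hp : 0 < p := by linarith
  have hpe : (ENNReal.ofReal p).toReal = p := ENNReal.toReal_ofReal hp.le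
  have key : ∀ {α : Type} [MeasurableSpace α] (μ : Measure α) (g : Lp ℝ (ENNReal.ofReal p) μ),
      ‖g‖ ^ p = ∫ x, |g x| ^ p ∂μ := by
    intro α _ μ g
    have hI : 0 ≤ ∫ x, |g x| ^ p ∂μ := integral_nonneg fun x => by positivity
    rw [Lp.norm_def, (Lp.memLp g).eLpNorm_eq_integral_rpow_norm (by simpa using hp)
      ENNReal.ofReal_ne_top, hpe, ENNReal.toReal_ofReal (by positivity)]
    simp only [Real.norm_eq_abs]
    rw [← Real.rpow_mul hI, inv_mul_cancel₀ hp.ne', Real.rpow_one]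
  have h0 : ‖u‖ = ‖toPair u‖ := rfl
  rw [h0, WithLp.prod_norm_eq_add (by rw [hpe]; exact hp), hpe]
  have h1 : (toPair u).fst = toLp u := rfl
  have h2 : (toPair u).snd = (memLp_gagliardoQuot u).toLp _ := rfl
  rw [h1, h2, key, key]
  congr 2
  refine integral_congr_ae ?_
  filter_upwards [(memLp_gagliardoQuot u).coeFn_toLp] with z hz
  rw [hz, gagliardoQuot, abs_div, Real.div_rpow (abs_nonneg _) (abs_nonneg _),
    abs_of_nonneg (Real.rpow_nonneg (norm_nonneg _) _), ← Real.rpow_mul (norm_nonneg _)]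
  congr 2
  field_simp

/-- `W_0^{s,p}(Ω)`: the elements of `W^{s,p}(ℝⁿ)` that vanish almost everywhere outside `Ω`,
with the norm of `W^{s,p}(ℝⁿ)`. -/
noncomputable def zeroOutside (s p : ℝ) [Fact (1 < p)] (Ω : Set (EuclideanSpace ℝ (Fin n))) :
    Submodule ℝ (FracSobolev n s p) where
  carrier := {u | ∀ᵐ x, x ∉ Ω → toLp u x = 0}
  zero_mem' := by
    show ∀ᵐ x, x ∉ Ω → toLp (0 : FracSobolev n s p) x = 0
    rw [map_zero]
    filter_upwards [Lp.coeFn_zero ℝ (ENNReal.ofReal p)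
      (volume : Measure (EuclideanSpace ℝ (Fin n)))] with x hx _
    simp
  add_mem' := by
    intro u v hu hv
    show ∀ᵐ x, x ∉ Ω → toLp (u + v) x = 0
    rw [map_add]
    filter_upwards [hu, hv, Lp.coeFn_add (toLp u) (toLp v)] with x h1 h2 h3 hx
    rw [h3, Pi.add_apply, h1 hx, h2 hx, add_zero]
  smul_mem' := by
    intro c u hu
    show ∀ᵐ x, x ∉ Ω → toLp (c • u) x = 0
    rw [map_smul]
    filter_upwards [hu, Lp.coeFn_smul c (toLp u)] with x h1 h2 hx
    rw [h2, Pi.smul_apply, h1 hx, smul_zero]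

end FracSobolev

/-- The integrand
`|u(x) - u(y)|^(p-2) (u(x) - u(y)) (v(x) - v(y)) / |x - y|^(n + sp)` of the weak form of the
fractional `p`-Laplacian. -/
noncomputable def pLapIntegrand {n : ℕ} (s p : ℝ) (u v : EuclideanSpace ℝ (Fin n) → ℝ)
    (z : EuclideanSpace ℝ (Fin n) × EuclideanSpace ℝ (Fin n)) : ℝ :=
  |u z.1 - u z.2| ^ (p - 2) * (u z.1 - u z.2) * (v z.1 - v z.2) /
    ‖z.1 - z.2‖ ^ ((n : ℝ) + s * p)

/-- For `Ω ⊆ D` and `f` in the dual of `W_0^{s,p}(D)`: `u` is the weak solution `u_Ω^f` of the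
Dirichlet problem `(-Δ_p)^s u = f` in `Ω`, `u = 0` outside `Ω`, that is, `u ∈ W_0^{s,p}(Ω)` and the
equation holds against every `v ∈ W_0^{s,p}(Ω)`. -/
def IsDirichletSolution {n : ℕ} {s p : ℝ} [Fact (1 < p)] {D : Set (EuclideanSpace ℝ (Fin n))}
    (Ω : Set (EuclideanSpace ℝ (Fin n))) (f : StrongDual ℝ (FracSobolev.zeroOutside s p D))
    (u : FracSobolev n s p) : Prop :=
  u ∈ FracSobolev.zeroOutside s p Ω ∧
    ∀ v : FracSobolev.zeroOutside s p D, (v : FracSobolev n s p) ∈ FracSobolev.zeroOutside s p Ω →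
      ∫ z, pLapIntegrand s p u.toLp (v : FracSobolev n s p).toLp z = f v

end FracPLap

/-! The support of `φ` is compact and at positive distance from `closure D \ Ω`, so Hausdorff
convergence of the complements puts it inside `Ωs k` for large `k`
(`eventually_subset_of_hausdorffCompl`). Then `φ` is admissible in the equation on `Ωs k`, and the
weak form at `u k` equals the fixed number `⟨f, φ⟩`. It remains to pass to the limit on the left,
and a subsequence is enough.

The weak form pairs `J(q_k)` in `L^{p'}` with the Gagliardo quotient of `φ` in `L^p`, where `J t =
|t|^(p-2) t` and `q_k` is the quotient of `u k`. Weak convergence does not pass through `J`, but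
almost everywhere convergence does, and together with boundedness in `L^{p'}` it gives weak
convergence of `J(q_k)` (`tendsto_integral_mul`).

Almost everywhere convergence of a subsequence comes from compactness in `L^1(D)`
(`exists_subseq_tendsto_ae`): integrals over balls of radius `r` are continuous functionals, so they
converge, while the deviation from ball means is at most a constant times `r^s`, uniformly in `k`.
-/

namespace FracPLap

/-! ### Weak convergence: boundedness, and the a.e. criterion in `L^q` -/

/-- A weakly convergent sequence is bounded. -/
theorem exists_norm_le_of_tendsto_eval {V : Type*} [NormedAddCommGroup V] [NormedSpace ℝ V]
    {u : ℕ → V} {a : V} (h : ∀ l : StrongDual ℝ V, Tendsto (fun k => l (u k)) atTop (𝓝 (l a))) :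
    ∃ M : ℝ, ∀ k, ‖u k‖ ≤ M := by
  -- The uniform boundedness principle is used on the dual, which is always complete; `V` need not
  -- be.
  obtain ⟨M, hM⟩ := banach_steinhaus (g := fun k => NormedSpace.inclusionInDoubleDual ℝ V (u k))
    (fun l => by
      obtain ⟨C, hC⟩ := (Metric.isBounded_range_of_tendsto _ (h l)).exists_norm_le
      exact ⟨C, fun k => hC _ ⟨k, rfl⟩⟩)
  refine ⟨M, fun k => ?_⟩
  have := hM k
  rwa [← (NormedSpace.inclusionInDoubleDualLi (E := V) ℝ).norm_map (u k)]

/-- A Young-type splitting according to whether `b ≤ ε a^(q-1)`. If so, `ab ≤ ε a^q`; if not, `a ≤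
(b/ε)^(p-1)` because `(q-1)(p-1) = 1`. Keeping the minimum with `ab` matters: it vanishes as `a → 0`
and stays dominated by a multiple of `b^p`, which suits dominated convergence. -/
theorem mul_le_min_add_rpow {p q : ℝ} (hpq : p.HolderConjugate q) (a b : ℝ≥0∞) {ε : ℝ≥0∞}
    (hε : ε ≠ 0) (hε' : ε ≠ ⊤) :
    a * b ≤ min (a * b) (ε⁻¹ ^ (p - 1) * b ^ p) + ε * a ^ q := by
  have hp := hpq.sub_one_pos
  have hq := hpq.symm.sub_one_pos
  have e1 : (q - 1) * (p - 1) = 1 := by linear_combination hpq.mul_eq_add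
  have pow_eq : ∀ (c : ℝ≥0∞) {t : ℝ}, 0 < t - 1 → c ^ t = c * c ^ (t - 1) := fun c t ht => by
    conv_lhs => rw [show t = 1 + (t - 1) by ring]
    rw [ENNReal.rpow_add_of_nonneg _ _ zero_le_one ht.le, ENNReal.rpow_one]
  rcases le_total b (ε * a ^ (q - 1)) with h | h
  · refine le_add_left ?_
    calc a * b ≤ a * (ε * a ^ (q - 1)) := by gcongr
      _ = ε * a ^ q := by rw [pow_eq a hq]; ring
  · refine le_add_right (le_min le_rfl ?_)
    have h2 : a ^ (q - 1) ≤ ε⁻¹ * b := by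
      rw [← ENNReal.div_eq_inv_mul, ENNReal.le_div_iff_mul_le (Or.inl hε) (Or.inl hε'), mul_comm]
      exact h
    calc a * b = (a ^ (q - 1)) ^ (p - 1) * b := by rw [← ENNReal.rpow_mul, e1, ENNReal.rpow_one]
      _ ≤ (ε⁻¹ * b) ^ (p - 1) * b := by gcongr
      _ = ε⁻¹ ^ (p - 1) * b ^ p := by rw [ENNReal.mul_rpow_of_nonneg _ _ hp.le, pow_eq b hp]; ring

/-- A sequence which is bounded in `L^q` and converges to zero almost everywhere converges to zero
when tested against a function in the dual space `L^p`. -/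
theorem tendsto_lintegral_mul_zero {α : Type*} [MeasurableSpace α] {μ : Measure α} {p q : ℝ}
    (hpq : p.HolderConjugate q) {h : ℕ → α → ℝ≥0∞} {g : α → ℝ≥0∞}
    (hm : ∀ k, AEMeasurable (h k) μ) (hg : AEMeasurable g μ)
    (hlim : ∀ᵐ x ∂μ, Tendsto (fun k => h k x) atTop (𝓝 0)) {M : ℝ≥0∞} (hM : M ≠ ⊤)
    (hb : ∀ k, ∫⁻ x, h k x ^ q ∂μ ≤ M) (hgp : ∫⁻ x, g x ^ p ∂μ ≠ ⊤) :
    Tendsto (fun k => ∫⁻ x, h k x * g x ∂μ) atTop (𝓝 0) := by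
  have hp := hpq.sub_one_pos
  rw [ENNReal.tendsto_nhds_zero]
  intro δ hδ
  -- `ε` makes the `h^q` term at most `δ/2` for every `k`; the minimum with 1 keeps it finite, since
  -- `δ` may be `⊤`.
  obtain ⟨ε, hε, hεM⟩ : ∃ ε : ℝ≥0∞, (ε ≠ 0 ∧ ε ≠ ⊤) ∧ ε * M ≤ δ / 2 := by
    rcases eq_or_ne M 0 with rfl | hM0
    · exact ⟨1, by simp, by simp⟩
    · refine ⟨min 1 (δ / 2 / M), ⟨?_, ?_⟩, ?_⟩
      · exact (lt_min one_pos (ENNReal.div_pos (ENNReal.half_pos hδ.ne').ne' hM)).ne'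
      · exact (min_le_left _ _).trans_lt ENNReal.one_lt_top |>.ne
      · calc _ ≤ δ / 2 / M * M := by gcongr; exact min_le_right _ _
          _ ≤ _ := by rw [mul_comm]; exact ENNReal.mul_div_le
  have hC : ε⁻¹ ^ (p - 1) ≠ ⊤ :=
    ENNReal.rpow_ne_top_of_nonneg hp.le (ENNReal.inv_ne_top.2 hε.1)
  have hgfin : ∀ᵐ x ∂μ, g x ≠ ⊤ := by
    filter_upwards [ae_lt_top' (hg.pow_const p) hgp] with x hx hx'
    rw [hx', ENNReal.top_rpow_of_pos hpq.pos] at hx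
    exact lt_irrefl _ hx
  have key : Tendsto (fun k => ∫⁻ x, min (h k x * g x) (ε⁻¹ ^ (p - 1) * g x ^ p) ∂μ) atTop
      (𝓝 (∫⁻ _, 0 ∂μ)) := by
    refine tendsto_lintegral_of_dominated_convergence' (fun x => ε⁻¹ ^ (p - 1) * g x ^ p)
      (fun k => ((hm k).mul hg).min ((hg.pow_const p).const_mul _))
      (fun k => ae_of_all _ fun x => min_le_right _ _) ?_ ?_
    · rw [lintegral_const_mul' _ _ hC]
      exact ENNReal.mul_ne_top hC hgp
    · filter_upwards [hlim, hgfin] with x hx hgx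
      have h1 : Tendsto (fun k => h k x * g x) atTop (𝓝 0) := by
        simpa using ENNReal.Tendsto.mul_const hx (Or.inr hgx)
      exact tendsto_of_tendsto_of_tendsto_of_le_of_le tendsto_const_nhds h1
        (fun _ => zero_le) (fun k => min_le_left _ _)
  rw [lintegral_zero, ENNReal.tendsto_nhds_zero] at key
  filter_upwards [key (δ / 2) (ENNReal.half_pos hδ.ne')] with k hk
  calc ∫⁻ x, h k x * g x ∂μ
      ≤ ∫⁻ x, (min (h k x * g x) (ε⁻¹ ^ (p - 1) * g x ^ p) + ε * h k x ^ q) ∂μ :=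
        lintegral_mono fun x => mul_le_min_add_rpow hpq _ _ hε.1 hε.2
    _ = (∫⁻ x, min (h k x * g x) (ε⁻¹ ^ (p - 1) * g x ^ p) ∂μ) + ε * ∫⁻ x, h k x ^ q ∂μ := by
        rw [← lintegral_const_mul' _ _ hε.2]; exact lintegral_add_left' (((hm k).mul hg).min ((hg.pow_const p).const_mul _)) _
    _ ≤ δ / 2 + δ / 2 := by gcongr; exact (mul_le_mul_right (hb k) _).trans hεM
    _ = δ := ENNReal.add_halves δ

/-- Almost everywhere convergence together with boundedness in `L^q`, `1 < q < ⊤`, implies weak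
convergence. -/
theorem tendsto_integral_mul {α : Type*} [MeasurableSpace α] {μ : Measure α} {p q : ℝ}
    (hpq : p.HolderConjugate q) {F : ℕ → α → ℝ} {F₀ G : α → ℝ}
    (hF : ∀ k, MemLp (F k) (ENNReal.ofReal q) μ) (hF₀ : MemLp F₀ (ENNReal.ofReal q) μ)
    (hG : MemLp G (ENNReal.ofReal p) μ)
    (hlim : ∀ᵐ x ∂μ, Tendsto (fun k => F k x) atTop (𝓝 (F₀ x))) {M : ℝ≥0∞} (hM : M ≠ ⊤)
    (hb : ∀ k, eLpNorm (F k) (ENNReal.ofReal q) μ ≤ M) :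
    Tendsto (fun k => ∫ x, F k x * G x ∂μ) atTop (𝓝 (∫ x, F₀ x * G x ∂μ)) := by
  have hp := hpq.pos
  have hq := hpq.symm.pos
  have hp0 : ENNReal.ofReal p ≠ 0 := by simpa using hp
  have hq0 : ENNReal.ofReal q ≠ 0 := by simpa using hq
  have hq1 : 1 ≤ ENNReal.ofReal q := by
    simpa using ENNReal.ofReal_le_ofReal hpq.symm.lt.le
  have htp : (ENNReal.ofReal p).toReal = p := ENNReal.toReal_ofReal hp.le
  have htq : (ENNReal.ofReal q).toReal = q := ENNReal.toReal_ofReal hq.le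
  have := hpq.symm.ennrealOfReal
  have hint : ∀ k, Integrable (fun x => F k x * G x) μ := fun k => (hF k).integrable_mul hG
  have hint₀ : Integrable (fun x => F₀ x * G x) μ := hF₀.integrable_mul hG
  refine tendsto_integral_of_L1 _ hint₀.1 (Eventually.of_forall hint) ?_
  have key := tendsto_lintegral_mul_zero (μ := μ) hpq (h := fun k x => ‖F k x - F₀ x‖ₑ)
    (g := fun x => ‖G x‖ₑ) (fun k => ((hF k).1.sub hF₀.1).enorm) hG.1.enorm ?_
    (M := (M + eLpNorm F₀ (ENNReal.ofReal q) μ) ^ q) ?_ ?_ ?_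
  · refine key.congr fun k => lintegral_congr fun x => ?_
    rw [← enorm_mul, sub_mul]
  · filter_upwards [hlim] with x hx
    have := (tendsto_sub_nhds_zero_iff.2 hx).enorm
    simpa using this
  · exact ENNReal.rpow_ne_top_of_nonneg hq.le (ENNReal.add_ne_top.2 ⟨hM, hF₀.2.ne⟩)
  · intro k
    have h1 : eLpNorm (F k - F₀) (ENNReal.ofReal q) μ ≤ M + eLpNorm F₀ (ENNReal.ofReal q) μ :=
      (eLpNorm_sub_le (hF k).1 hF₀.1 hq1).trans (by gcongr; exact hb k)
    rw [eLpNorm_eq_lintegral_rpow_enorm_toReal hq0 ENNReal.ofReal_ne_top, htq, one_div,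
      ENNReal.rpow_inv_le_iff hq] at h1
    exact h1
  · have := lintegral_rpow_enorm_lt_top_of_eLpNorm_lt_top hp0 ENNReal.ofReal_ne_top hG.2
    rw [htp] at this
    exact this.ne

/-! ### Hausdorff complementary convergence -/

/-- Hausdorff convergence of the complements in a closed set: compact subsets of the limit are
eventually contained in the approximating sets. -/
theorem eventually_subset_of_hausdorffCompl {n : ℕ} {K : Set (EuclideanSpace ℝ (Fin n))}
    (hK : IsClosed K) {Ωs : ℕ → Set (EuclideanSpace ℝ (Fin n))}
    {Ω C : Set (EuclideanSpace ℝ (Fin n))} (hΩ : IsOpen Ω)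
    (hconv : Tendsto (fun k => hausdorffComplEDist K (Ωs k) Ω) atTop (𝓝 0))
    (hC : IsCompact C) (hCK : C ⊆ K) (hCΩ : C ⊆ Ω) : ∀ᶠ k in atTop, C ⊆ Ωs k := by
  obtain ⟨r, hr, hrd⟩ := Metric.exists_pos_forall_lt_edist hC (hK.sdiff hΩ)
    (Set.disjoint_left.2 fun x hx hx' => hx'.2 (hCΩ hx))
  filter_upwards [hconv.eventually_lt_const (show (0 : ℝ≥0∞) < r by exact_mod_cast hr)]
    with k hk x hx
  by_contra hxk
  -- A point of `C` missed by `Ωs k` would be closer than `r` to `K \ Ω`, although `C` stays at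
  -- distance more than `r` from it.
  obtain ⟨y, hy, hxy⟩ := Metric.exists_edist_lt_of_hausdorffEDist_lt
    (show x ∈ K \ Ωs k from ⟨hCK hx, hxk⟩) hk
  exact lt_asymm hxy (hrd x hx y hy)

/-! ### Oscillation at scale `r` -/

theorem enorm_sub_le_gagliardoQuot {n : ℕ} {s p r : ℝ} (hα : 0 ≤ (n : ℝ) / p + s)
    (w : EuclideanSpace ℝ (Fin n) → ℝ) {x y : EuclideanSpace ℝ (Fin n)} (hxy : dist x y ≤ r) :
    ‖w x - w y‖ₑ ≤ ENNReal.ofReal (r ^ ((n : ℝ) / p + s)) * ‖gagliardoQuot s p w (x, y)‖ₑ := by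
  rcases eq_or_ne x y with rfl | hne
  · simp
  have hd : 0 < ‖x - y‖ := norm_pos_iff.2 (sub_ne_zero.2 hne)
  have h1 : w x - w y = ‖x - y‖ ^ ((n : ℝ) / p + s) * gagliardoQuot s p w (x, y) := by
    simp only [gagliardoQuot]
    rw [mul_div_cancel₀ _ (Real.rpow_pos_of_pos hd _).ne']
  rw [h1, enorm_mul, Real.enorm_of_nonneg (by positivity)]
  gcongr
  rwa [← dist_eq_norm]

/-- The average of `|w|` over `D` is controlled by the means of `w` on balls of radius `r` and
the Gagliardo seminorm of `w` times a power of `r`. -/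
theorem lintegral_enorm_le_ball_add_gagliardo {n : ℕ} {s p r : ℝ} (hs : 0 < s) (hp : 1 < p)
    (hr : 0 < r) {w : EuclideanSpace ℝ (Fin n) → ℝ} (hw : LocallyIntegrable w volume)
    (hwm : StronglyMeasurable w) {D : Set (EuclideanSpace ℝ (Fin n))} (hD : MeasurableSet D) :
    (ENNReal.ofReal (r ^ n) * volume (Metric.ball (0 : EuclideanSpace ℝ (Fin n)) 1)) *
        ∫⁻ x in D, ‖w x‖ₑ ≤
      (∫⁻ x in D, ‖∫ y in Metric.ball x r, w y‖ₑ) +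
        ENNReal.ofReal (r ^ ((n : ℝ) / p + s)) *
          (eLpNorm (gagliardoQuot s p w) (ENNReal.ofReal p) volume *
            (ENNReal.ofReal (r ^ n) * volume (Metric.ball (0 : EuclideanSpace ℝ (Fin n)) 1) *
              volume D) ^ (1 - 1 / p)) := by
  set V := ENNReal.ofReal (r ^ n) * volume (Metric.ball (0 : EuclideanSpace ℝ (Fin n)) 1) with hV
  have hα : 0 ≤ (n : ℝ) / p + s := by positivity
  have hball : ∀ x : EuclideanSpace ℝ (Fin n), volume (Metric.ball x r) = V := fun x => by
    rw [Measure.addHaar_ball_of_pos _ _ hr]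
    simp [hV]
  have hfin : ∀ x : EuclideanSpace ℝ (Fin n), volume (Metric.ball x r) ≠ ⊤ := fun x =>
    measure_ball_lt_top.ne
  have hint : ∀ x : EuclideanSpace ℝ (Fin n), IntegrableOn w (Metric.ball x r) := fun x =>
    (hw.integrableOn_isCompact (isCompact_closedBall x r)).mono_set Metric.ball_subset_closedBall
  have hwm2 : StronglyMeasurable fun z : EuclideanSpace ℝ (Fin n) × EuclideanSpace ℝ (Fin n) =>
      w z.1 - w z.2 := (hwm.comp_measurable measurable_fst).sub (hwm.comp_measurable measurable_snd)
  have hqm : StronglyMeasurable (gagliardoQuot s p w) := by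
    unfold gagliardoQuot
    exact (hwm2.measurable.div (by fun_prop)).stronglyMeasurable
  set E : Set (EuclideanSpace ℝ (Fin n) × EuclideanSpace ℝ (Fin n)) :=
    {z | z.1 ∈ D ∧ z.2 ∈ Metric.ball z.1 r} with hE
  have hEm : MeasurableSet E :=
    (measurable_fst hD).inter
      (isOpen_lt (by fun_prop : Continuous fun z : EuclideanSpace ℝ (Fin n) ×
        EuclideanSpace ℝ (Fin n) => dist z.2 z.1) continuous_const).measurableSet
  -- Write `w x` as its mean over the ball plus the mean of `w x - w y`, multiplied through by the
  -- ball volume `V` to avoid division.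
  have hsplit : ∀ x, V * ‖w x‖ₑ ≤ ‖∫ y in Metric.ball x r, w y‖ₑ +
      ∫⁻ y in Metric.ball x r, ‖w x - w y‖ₑ := by
    intro x
    have h1 : ∫ y in Metric.ball x r, w x = (∫ y in Metric.ball x r, w y) +
        ∫ y in Metric.ball x r, (w x - w y) := by
      have hc : IntegrableOn (fun _ => w x) (Metric.ball x r) := integrableOn_const (hfin x)
      rw [integral_sub hc (hint x)]
      ring
    have h2 : V * ‖w x‖ₑ = ‖∫ y in Metric.ball x r, w x‖ₑ := by
      rw [setIntegral_const, smul_eq_mul, enorm_mul, Measure.real,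
        Real.enorm_of_nonneg ENNReal.toReal_nonneg, ENNReal.ofReal_toReal (hfin x), hball]
    rw [h2, h1]
    refine (enorm_add_le _ _).trans ?_
    gcongr
    exact enorm_integral_le_lintegral_enorm _
  have hiter : ∀ g : EuclideanSpace ℝ (Fin n) × EuclideanSpace ℝ (Fin n) → ℝ≥0∞, Measurable g →
      ∫⁻ x in D, ∫⁻ y in Metric.ball x r, g (x, y) = ∫⁻ z in E, g z := by
    intro g hg
    rw [← lintegral_indicator hEm, Measure.volume_eq_prod,
      lintegral_prod _ (hg.indicator hEm).aemeasurable, ← lintegral_indicator hD]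
    refine lintegral_congr fun x => ?_
    by_cases hx : x ∈ D
    · rw [Set.indicator_of_mem hx, ← lintegral_indicator measurableSet_ball]
      refine lintegral_congr fun y => ?_
      by_cases hy : y ∈ Metric.ball x r
      · rw [Set.indicator_of_mem hy, Set.indicator_of_mem (show (x, y) ∈ E from ⟨hx, hy⟩)]
      · rw [Set.indicator_of_notMem hy,
          Set.indicator_of_notMem (show (x, y) ∉ E from fun h => hy h.2)]
    · rw [Set.indicator_of_notMem hx]
      refine (lintegral_eq_zero_of_ae_eq_zero (ae_of_all _ fun y => ?_)).symm
      exact Set.indicator_of_notMem (fun h => hx h.1) _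
  have hEvol : volume E = V * volume D := by
    have := hiter (fun _ => 1) measurable_const
    simp only [lintegral_const, one_mul, Measure.restrict_apply MeasurableSet.univ,
      Set.univ_inter, hball] at this
    exact this.symm
  have hp1 : (1 : ℝ≥0∞) ≤ ENNReal.ofReal p := by simpa using ENNReal.ofReal_le_ofReal hp.le
  -- On `E` the increment is at most `r^(n/p+s)` times the quotient; Hölder on `E`, of measure `V
  -- |D|`, then passes from `L^1` to `L^p`.
  have hosc : ∫⁻ x in D, ∫⁻ y in Metric.ball x r, ‖w x - w y‖ₑ ≤
      ENNReal.ofReal (r ^ ((n : ℝ) / p + s)) *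
        (eLpNorm (gagliardoQuot s p w) (ENNReal.ofReal p) volume *
          (V * volume D) ^ (1 - 1 / p)) := by
    rw [hiter (fun z => ‖w z.1 - w z.2‖ₑ) hwm2.measurable.enorm]
    calc ∫⁻ z in E, ‖w z.1 - w z.2‖ₑ
        ≤ ∫⁻ z in E, ENNReal.ofReal (r ^ ((n : ℝ) / p + s)) * ‖gagliardoQuot s p w z‖ₑ := by
          refine setLIntegral_mono (hqm.measurable.enorm.const_mul _) fun z hz => ?_
          refine enorm_sub_le_gagliardoQuot hα w ?_
          rw [dist_comm]
          exact (Metric.mem_ball.1 hz.2).le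
      _ = ENNReal.ofReal (r ^ ((n : ℝ) / p + s)) *
          eLpNorm (gagliardoQuot s p w) 1 (volume.restrict E) := by
          rw [lintegral_const_mul _ hqm.measurable.enorm, eLpNorm_one_eq_lintegral_enorm]
      _ ≤ _ := by
          gcongr
          refine (eLpNorm_le_eLpNorm_mul_rpow_measure_univ hp1
            hqm.aestronglyMeasurable).trans ?_
          rw [Measure.restrict_apply_univ, hEvol, ENNReal.toReal_ofReal (by linarith),
            ENNReal.toReal_one, one_div_one]
          gcongr
          exact Measure.restrict_le_self
  calc V * ∫⁻ x in D, ‖w x‖ₑ = ∫⁻ x in D, V * ‖w x‖ₑ :=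
        (lintegral_const_mul _ hwm.measurable.enorm).symm
    _ ≤ ∫⁻ x in D, (‖∫ y in Metric.ball x r, w y‖ₑ +
          ∫⁻ y in Metric.ball x r, ‖w x - w y‖ₑ) := lintegral_mono hsplit
    _ ≤ _ := by
      have hmeas : Measurable fun x => ∫⁻ y in Metric.ball x r, ‖w x - w y‖ₑ := by
        have h3 : ∀ x, ∫⁻ y in Metric.ball x r, ‖w x - w y‖ₑ =
            ∫⁻ y, {z : EuclideanSpace ℝ (Fin n) × EuclideanSpace ℝ (Fin n) |
              dist z.2 z.1 < r}.indicator (fun z => ‖w z.1 - w z.2‖ₑ) (x, y) := fun x => by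
          rw [← lintegral_indicator measurableSet_ball]
          rfl
        simp_rw [h3]
        refine Measurable.lintegral_prod_right' (hwm2.measurable.enorm.indicator ?_)
        exact (isOpen_lt (by fun_prop : Continuous fun z : EuclideanSpace ℝ (Fin n) ×
          EuclideanSpace ℝ (Fin n) => dist z.2 z.1) continuous_const).measurableSet
      rw [lintegral_add_right _ hmeas]
      gcongr

/-! ### Compactness of `W_0^{s,p}(D)` in `L^1(D)` -/

namespace FracSobolev

variable {n : ℕ} {s p : ℝ} [Fact (1 < p)]

theorem eLpNorm_toLp_le (u : FracSobolev n s p) :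
    eLpNorm (toLp u) (ENNReal.ofReal p) volume ≤ ENNReal.ofReal ‖u‖ := by
  have h : ‖toLp u‖ₑ ≤ ‖toPair u‖ₑ := WithLp.enorm_fst_le _ (toPair u)
  rw [Lp.enorm_def, ← ofReal_norm] at h
  exact h

theorem eLpNorm_gagliardoQuot_le (u : FracSobolev n s p) :
    eLpNorm (gagliardoQuot s p (toLp u)) (ENNReal.ofReal p) volume ≤ ENNReal.ofReal ‖u‖ := by
  have h : ‖(memLp_gagliardoQuot u).toLp _‖ₑ ≤ ‖toPair u‖ₑ := WithLp.enorm_snd_le _ (toPair u)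
  rw [Lp.enorm_toLp, ← ofReal_norm] at h
  exact h

theorem one_le_ofReal_exponent : (1 : ℝ≥0∞) ≤ ENNReal.ofReal p := Fact.out

theorem locallyIntegrable_toLp (u : FracSobolev n s p) : LocallyIntegrable (toLp u) volume :=
  (Lp.memLp (toLp u)).locallyIntegrable one_le_ofReal_exponent

theorem setLIntegral_enorm_toLp_le (u : FracSobolev n s p)
    (B : Set (EuclideanSpace ℝ (Fin n))) :
    ∫⁻ x in B, ‖toLp u x‖ₑ ≤ ENNReal.ofReal ‖u‖ * volume B ^ (1 - 1 / p) := by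
  have hp : 1 < p := Fact.out
  rw [← eLpNorm_one_eq_lintegral_enorm]
  refine (eLpNorm_le_eLpNorm_mul_rpow_measure_univ (one_le_ofReal_exponent (p := p))
    (Lp.memLp (toLp u)).1.restrict).trans ?_
  rw [Measure.restrict_apply_univ, ENNReal.toReal_ofReal (by linarith), ENNReal.toReal_one,
    one_div_one]
  gcongr
  exact (eLpNorm_mono_measure _ Measure.restrict_le_self).trans (eLpNorm_toLp_le u)

/-- Integration over a ball, as a continuous linear functional on `W^{s,p}`. -/
noncomputable def ballIntegral (x : EuclideanSpace ℝ (Fin n)) (r : ℝ) :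
    StrongDual ℝ (FracSobolev n s p) :=
  LinearMap.mkContinuous
    { toFun := fun u => ∫ y in Metric.ball x r, toLp u y
      map_add' := fun u v => by
        have hi : ∀ w : FracSobolev n s p, IntegrableOn (toLp w) (Metric.ball x r) := fun w =>
          ((locallyIntegrable_toLp w).integrableOn_isCompact
            (isCompact_closedBall x r)).mono_set Metric.ball_subset_closedBall
        rw [← integral_add (hi u) (hi v), map_add]
        refine integral_congr_ae (ae_restrict_of_ae ?_)
        filter_upwards [Lp.coeFn_add (toLp u) (toLp v)] with y hy
        rw [hy, Pi.add_apply]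
      map_smul' := fun c u => by
        rw [RingHom.id_apply, smul_eq_mul, ← integral_const_mul, map_smul]
        refine integral_congr_ae (ae_restrict_of_ae ?_)
        filter_upwards [Lp.coeFn_smul c (toLp u)] with y hy
        rw [hy, Pi.smul_apply, smul_eq_mul] }
    (volume (Metric.ball x r) ^ (1 - 1 / p)).toReal
    (fun u => by
      have hp : 1 < p := Fact.out
      have hfin : volume (Metric.ball x r) ^ (1 - 1 / p) ≠ ⊤ :=
        ENNReal.rpow_ne_top_of_nonneg
          (by rw [sub_nonneg, div_le_one (by linarith)]; exact hp.le) measure_ball_lt_top.ne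
      have h := (enorm_integral_le_lintegral_enorm _).trans
        (setLIntegral_enorm_toLp_le u (Metric.ball x r))
      have h2 := ENNReal.toReal_mono (ENNReal.mul_ne_top ENNReal.ofReal_ne_top hfin) h
      rw [toReal_enorm, ENNReal.toReal_mul, ENNReal.toReal_ofReal (norm_nonneg _)] at h2
      rw [mul_comm]
      exact h2)

theorem ballIntegral_apply (x : EuclideanSpace ℝ (Fin n)) (r : ℝ) (u : FracSobolev n s p) :
    ballIntegral x r u = ∫ y in Metric.ball x r, toLp u y := rfl

/-- A bounded sequence in `W^{s,p}` whose integrals over all balls tend to zero converges to zero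
in `L^1` on every set of finite measure. -/
theorem tendsto_setLIntegral_of_ballIntegral (hs : 0 < s) {w : ℕ → FracSobolev n s p} {M : ℝ}
    (hM : ∀ k, ‖w k‖ ≤ M)
    (hlim : ∀ x r, 0 < r → Tendsto (fun k => ballIntegral x r (w k)) atTop (𝓝 0))
    {D : Set (EuclideanSpace ℝ (Fin n))} (hD : MeasurableSet D) (hDfin : volume D ≠ ⊤) :
    Tendsto (fun k => ∫⁻ x in D, ‖toLp (w k) x‖ₑ) atTop (𝓝 0) := by
  have hp : 1 < p := Fact.out
  have hθ : 0 ≤ 1 - 1 / p := by rw [sub_nonneg, div_le_one (by linarith)]; exact hp.le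
  set v := volume (Metric.ball (0 : EuclideanSpace ℝ (Fin n)) 1) with hv
  have hv0 : v ≠ 0 := (Metric.measure_ball_pos _ _ one_pos).ne'
  have hvt : v ≠ ⊤ := measure_ball_lt_top.ne
  set C := ENNReal.ofReal M * (v * volume D) ^ (1 - 1 / p) with hC
  have hCt : C ≠ ⊤ := ENNReal.mul_ne_top ENNReal.ofReal_ne_top
    (ENNReal.rpow_ne_top_of_nonneg hθ (ENNReal.mul_ne_top hvt hDfin))
  rw [ENNReal.tendsto_nhds_zero]
  intro δ hδ
  have hvδ : 0 < v * (δ / 2) := ENNReal.mul_pos hv0 (ENNReal.half_pos hδ.ne').ne'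
  -- After division by the ball volume `r^n v`, the oscillation term is `r^s C / v`; this `r` makes
  -- it at most `δ/2` for all `k` at once.
  obtain ⟨r, hr, hrC⟩ : ∃ r : ℝ, 0 < r ∧ ENNReal.ofReal (r ^ s) * C ≤ v * (δ / 2) := by
    have h1 : Tendsto (fun r : ℝ => ENNReal.ofReal (r ^ s) * C) (𝓝 0) (𝓝 0) := by
      have h2 : Tendsto (fun r : ℝ => r ^ s) (𝓝 0) (𝓝 0) := by
        simpa [Real.zero_rpow hs.ne'] using
          (Real.continuousAt_rpow_const 0 s (Or.inr hs.le)).tendsto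
      simpa using ENNReal.Tendsto.mul_const (ENNReal.tendsto_ofReal h2) (Or.inr hCt)
    have h3 := (h1.mono_left (nhdsWithin_le_nhds (s := Set.Ioi 0))).eventually_le_const hvδ
    obtain ⟨r, hr⟩ := (h3.and self_mem_nhdsWithin).exists
    exact ⟨r, hr.2, hr.1⟩
  have hrn0 : ENNReal.ofReal (r ^ n) ≠ 0 := by simpa using pow_pos hr n
  -- With `r` fixed, ball integrals tend to zero at every centre and are bounded uniformly in centre
  -- and `k`; finite measure of `D` gives domination.
  have hmean : Tendsto (fun k => ∫⁻ x in D, ‖∫ y in Metric.ball x r, toLp (w k) y‖ₑ) atTop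
      (𝓝 (∫⁻ _ in D, 0)) := by
    refine tendsto_lintegral_of_dominated_convergence
      (fun _ => ENNReal.ofReal M * (ENNReal.ofReal (r ^ n) * v) ^ (1 - 1 / p)) ?_ ?_ ?_ ?_
    · intro k
      have h3 : ∀ x, ∫ y in Metric.ball x r, toLp (w k) y =
          ∫ y, {z : EuclideanSpace ℝ (Fin n) × EuclideanSpace ℝ (Fin n) |
            dist z.2 z.1 < r}.indicator (fun z => toLp (w k) z.2) (x, y) := fun x => by
        rw [← integral_indicator measurableSet_ball]
        rfl
      simp_rw [h3]
      refine (StronglyMeasurable.integral_prod_right' (StronglyMeasurable.indicator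
        ((Lp.stronglyMeasurable _).comp_measurable measurable_snd) ?_)).measurable.enorm
      exact (isOpen_lt (by fun_prop : Continuous fun z : EuclideanSpace ℝ (Fin n) ×
        EuclideanSpace ℝ (Fin n) => dist z.2 z.1) continuous_const).measurableSet
    · refine fun k => ae_of_all _ fun x => ?_
      refine (enorm_integral_le_lintegral_enorm _).trans
        ((setLIntegral_enorm_toLp_le (w k) _).trans ?_)
      rw [Measure.addHaar_ball_of_pos _ _ hr, finrank_euclideanSpace_fin]
      exact mul_le_mul' (ENNReal.ofReal_le_ofReal (hM k)) le_rfl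
    · rw [lintegral_const, Measure.restrict_apply_univ]
      exact ENNReal.mul_ne_top (ENNReal.mul_ne_top ENNReal.ofReal_ne_top
        (ENNReal.rpow_ne_top_of_nonneg hθ (ENNReal.mul_ne_top ENNReal.ofReal_ne_top hvt))) hDfin
    · refine ae_of_all _ fun x => ?_
      simpa [ballIntegral_apply] using (hlim x r hr).enorm
  rw [lintegral_zero] at hmean
  have hc0 : ENNReal.ofReal (r ^ n) * v ≠ 0 := mul_ne_zero hrn0 hv0
  have hct : ENNReal.ofReal (r ^ n) * v ≠ ⊤ := ENNReal.mul_ne_top ENNReal.ofReal_ne_top hvt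
  filter_upwards [ENNReal.tendsto_nhds_zero.1 hmean (ENNReal.ofReal (r ^ n) * v * (δ / 2))
    (ENNReal.mul_pos hc0 (ENNReal.half_pos hδ.ne').ne')] with k hk
  refine (ENNReal.mul_le_mul_iff_right hc0 hct).1 ?_
  have hexp : ENNReal.ofReal (r ^ ((n : ℝ) / p + s)) * ENNReal.ofReal (r ^ n) ^ (1 - 1 / p) =
      ENNReal.ofReal (r ^ n) * ENNReal.ofReal (r ^ s) := by
    rw [ENNReal.ofReal_rpow_of_nonneg (by positivity) hθ, ← ENNReal.ofReal_mul (by positivity),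
      ← ENNReal.ofReal_mul (by positivity), ← Real.rpow_natCast, ← Real.rpow_mul hr.le,
      ← Real.rpow_add hr, ← Real.rpow_add hr]
    congr 2
    ring
  calc ENNReal.ofReal (r ^ n) * v * ∫⁻ x in D, ‖toLp (w k) x‖ₑ
      ≤ _ := lintegral_enorm_le_ball_add_gagliardo hs hp hr (locallyIntegrable_toLp (w k))
        (Lp.stronglyMeasurable _) hD
    _ ≤ ENNReal.ofReal (r ^ n) * v * (δ / 2) + ENNReal.ofReal (r ^ ((n : ℝ) / p + s)) *
        (ENNReal.ofReal M * (ENNReal.ofReal (r ^ n) * v * volume D) ^ (1 - 1 / p)) := by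
        gcongr
        exact (eLpNorm_gagliardoQuot_le (w k)).trans (ENNReal.ofReal_le_ofReal (hM k))
    _ = ENNReal.ofReal (r ^ n) * v * (δ / 2) +
        ENNReal.ofReal (r ^ n) * (ENNReal.ofReal (r ^ s) * C) := by
        rw [mul_assoc (ENNReal.ofReal (r ^ n)) v (volume D), ENNReal.mul_rpow_of_nonneg _ _ hθ,
          ← mul_assoc (ENNReal.ofReal (r ^ n)) (ENNReal.ofReal (r ^ s)) C, ← hexp, hC]
        ring
    _ ≤ ENNReal.ofReal (r ^ n) * v * (δ / 2) + ENNReal.ofReal (r ^ n) * (v * (δ / 2)) := by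
        gcongr
    _ = ENNReal.ofReal (r ^ n) * v * δ := by
        rw [← mul_assoc, ← mul_add, ENNReal.add_halves]

/-- A weakly convergent sequence in `W_0^{s,p}(D)`, with `D` bounded, has a subsequence which
converges almost everywhere. -/
theorem exists_subseq_tendsto_ae (hs : 0 < s) {D : Set (EuclideanSpace ℝ (Fin n))}
    (hD : MeasurableSet D) (hDfin : volume D ≠ ⊤) {u : ℕ → zeroOutside s p D}
    {a : zeroOutside s p D}
    (h : ∀ l : StrongDual ℝ (zeroOutside s p D), Tendsto (fun k => l (u k)) atTop (𝓝 (l a))) :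
    ∃ ns : ℕ → ℕ, StrictMono ns ∧ ∀ᵐ x, Tendsto
      (fun j => toLp (u (ns j) : FracSobolev n s p) x) atTop
        (𝓝 (toLp (a : FracSobolev n s p) x)) := by
  obtain ⟨M, hM⟩ := exists_norm_le_of_tendsto_eval h
  have h1 := tendsto_setLIntegral_of_ballIntegral (w := fun k => (u k - a : FracSobolev n s p))
    (M := M + ‖a‖) hs (fun k => (norm_sub_le _ _).trans (add_le_add_left (hM k) _))
    (fun x r _ => by
      have h2 := h ((ballIntegral x r).comp (zeroOutside s p D).subtypeL)
      have h3 := tendsto_sub_nhds_zero_iff.2 h2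
      refine h3.congr fun k => ?_
      rw [map_sub]
      rfl) hD hDfin
  -- Convergence in `L^1(D)` implies convergence in measure on `D`, hence a.e. along a subsequence;
  -- off `D` all the functions vanish.
  have hm : TendstoInMeasure (volume.restrict D) (fun k => toLp (u k : FracSobolev n s p)) atTop
      (toLp (a : FracSobolev n s p)) := by
    refine tendstoInMeasure_of_tendsto_eLpNorm (p := 1) one_ne_zero
      (fun k => (Lp.stronglyMeasurable _).aestronglyMeasurable)
      (Lp.stronglyMeasurable _).aestronglyMeasurable ?_
    refine h1.congr fun k => ?_
    rw [eLpNorm_one_eq_lintegral_enorm]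
    refine lintegral_congr_ae (ae_restrict_of_ae ?_)
    rw [map_sub]
    filter_upwards [Lp.coeFn_sub (toLp (u k : FracSobolev n s p)) (toLp (a : FracSobolev n s p))]
      with x hx
    rw [hx]
  obtain ⟨ns, hns, hae⟩ := hm.exists_seq_tendsto_ae
  refine ⟨ns, hns, ?_⟩
  rw [ae_restrict_iff' hD] at hae
  have hu : ∀ᵐ x, ∀ k, x ∉ D → toLp (u k : FracSobolev n s p) x = 0 :=
    ae_all_iff.2 fun k => (u k).2
  have ha : ∀ᵐ x, x ∉ D → toLp (a : FracSobolev n s p) x = 0 := a.2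
  filter_upwards [hae, hu, ha] with x h1 h2 h3
  by_cases hx : x ∈ D
  · exact h1 hx
  · simp only [h2 _ hx, h3 hx]
    exact tendsto_const_nhds

end FracSobolev

/-! ### Test functions belong to `W^{s,p}` -/

/-- The profile `r ↦ min(L r, M)^p / r^(n + sp)` is integrable over `ℝⁿ`. -/
theorem integrable_min_rpow_div {n : ℕ} [Nontrivial (EuclideanSpace ℝ (Fin n))] {s p : ℝ}
    (hs₀ : 0 < s) (hs₁ : s < 1) (hp : 1 < p) {L M : ℝ} (hL : 0 ≤ L) (hM : 0 ≤ M) :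
    Integrable (fun h : EuclideanSpace ℝ (Fin n) =>
      (min (L * ‖h‖) M / ‖h‖ ^ ((n : ℝ) / p + s)) ^ p) volume := by
  have hn : 0 < n := by
    rcases Nat.eq_zero_or_pos n with rfl | h
    · exact absurd ‹Nontrivial (EuclideanSpace ℝ (Fin 0))› (not_nontrivial _)
    · exact h
  refine (integrable_fun_norm_addHaar volume
    (f := fun r : ℝ => (min (L * r) M / r ^ ((n : ℝ) / p + s)) ^ p)).2 ?_
  rw [finrank_euclideanSpace_fin]
  have hmeas : Measurable fun r : ℝ =>
      r ^ (n - 1) • (min (L * r) M / r ^ ((n : ℝ) / p + s)) ^ p := by fun_prop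
  -- The polar-coordinate weight combines with the kernel as `n - 1 - (n + sp) = -1 - sp`.
  have hform : ∀ r : ℝ, 0 < r → ∀ m : ℝ, 0 ≤ m →
      r ^ (n - 1) • (m / r ^ ((n : ℝ) / p + s)) ^ p = m ^ p * r ^ (-1 - s * p) := by
    intro r hr m hm
    rw [smul_eq_mul, Real.div_rpow hm (by positivity), ← Real.rpow_mul hr.le, mul_div_left_comm,
      ← Real.rpow_natCast, ← Real.rpow_sub hr, Nat.cast_sub hn]
    congr 2
    field_simp
    push_cast
    ring
  rw [← Set.Ioc_union_Ioi_eq_Ioi (zero_le_one (α := ℝ)), integrableOn_union]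
  constructor
  -- Near the origin the Lipschitz branch leaves the exponent `p - 1 - sp`, above `-1` because `s <
  -- 1`.
  · have h1 : IntegrableOn (fun r : ℝ => L ^ p * r ^ (p - 1 - s * p)) (Set.Ioc 0 1) := by
      refine Integrable.const_mul ?_ _
      rw [← IntegrableOn, ← intervalIntegrable_iff_integrableOn_Ioc_of_le zero_le_one]
      exact intervalIntegral.intervalIntegrable_rpow' (by nlinarith)
    refine Integrable.mono' h1 hmeas.aestronglyMeasurable
      ((ae_restrict_iff' measurableSet_Ioc).2 (ae_of_all _ fun r hr => ?_))
    have hr0 : 0 < r := hr.1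
    have hm : 0 ≤ min (L * r) M := le_min (by positivity) hM
    rw [hform r hr0 _ hm, Real.norm_of_nonneg (by positivity)]
    calc (min (L * r) M) ^ p * r ^ (-1 - s * p) ≤ (L * r) ^ p * r ^ (-1 - s * p) := by
          gcongr
          exact min_le_left _ _
      _ = L ^ p * r ^ (p - 1 - s * p) := by
          rw [Real.mul_rpow hL hr0.le, mul_assoc, ← Real.rpow_add hr0]
          congr 2
          ring
  -- At infinity the bounded branch leaves `-1 - sp`, below `-1` because `s > 0`.
  · have h1 : IntegrableOn (fun r : ℝ => M ^ p * r ^ (-1 - s * p)) (Set.Ioi 1) :=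
      (integrableOn_Ioi_rpow_of_lt (by nlinarith) one_pos).const_mul _
    refine Integrable.mono' h1 hmeas.aestronglyMeasurable
      ((ae_restrict_iff' measurableSet_Ioi).2 (ae_of_all _ fun r hr => ?_))
    have hr0 : 0 < r := one_pos.trans hr
    have hm : 0 ≤ min (L * r) M := le_min (by positivity) hM
    rw [hform r hr0 _ hm, Real.norm_of_nonneg (by positivity)]
    gcongr
    exact min_le_right _ _

/-- Compactly supported smooth functions have a finite Gagliardo seminorm. -/
theorem memLp_gagliardoQuot_of_contDiff {n : ℕ} {s p : ℝ} (hs₀ : 0 < s) (hs₁ : s < 1)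
    (hp : 1 < p) {φ : EuclideanSpace ℝ (Fin n) → ℝ} (hφ : ContDiff ℝ ∞ φ)
    (hφc : HasCompactSupport φ) :
    MemLp (gagliardoQuot s p φ) (ENNReal.ofReal p) volume := by
  -- In dimension zero there are no radii to integrate over, but every increment vanishes.
  rcases subsingleton_or_nontrivial (EuclideanSpace ℝ (Fin n)) with hsub | hnon
  · have : gagliardoQuot s p φ = 0 := by
      funext z
      simp [gagliardoQuot, Subsingleton.elim z.1 z.2]
    rw [this]
    exact MemLp.zero
  have hp0 : 0 < p := by linarith
  have htp : (ENNReal.ofReal p).toReal = p := ENNReal.toReal_ofReal hp0.le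
  obtain ⟨L, hL⟩ := ContDiff.lipschitzWith_of_hasCompactSupport hφc hφ (by simp)
  obtain ⟨M, hM⟩ := hφc.exists_bound_of_continuous hφ.continuous
  have hM0 : 0 ≤ M := (norm_nonneg _).trans (hM 0)
  set K := tsupport φ with hK
  have hKfin : volume K ≠ ⊤ := hφc.measure_lt_top.ne
  have hKm : MeasurableSet K := (isClosed_tsupport φ).measurableSet
  have hcm : Measurable φ := hφ.continuous.measurable
  have hqm : Measurable (gagliardoQuot s p φ) := by
    unfold gagliardoQuot
    fun_prop
  set H : EuclideanSpace ℝ (Fin n) → ℝ≥0∞ := fun h =>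
    ‖(min (L * ‖h‖) (M + M) / ‖h‖ ^ ((n : ℝ) / p + s)) ^ p‖ₑ with hH
  have hHm : Measurable H := by rw [hH]; fun_prop
  have hHfin : ∫⁻ h, H h ≠ ⊤ :=
    (integrable_min_rpow_div hs₀ hs₁ hp L.2 (add_nonneg hM0 hM0)).2.ne
  have hbound : ∀ z, ‖gagliardoQuot s p φ z‖ₑ ^ p ≤ H (z.1 - z.2) := by
    intro z
    have h1 : ‖gagliardoQuot s p φ z‖ ≤
        min (L * ‖z.1 - z.2‖) (M + M) / ‖z.1 - z.2‖ ^ ((n : ℝ) / p + s) := by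
      rw [gagliardoQuot, norm_div, Real.norm_of_nonneg (r := _ ^ _) (by positivity)]
      gcongr
      refine le_min ?_ ((norm_sub_le _ _).trans (add_le_add (hM _) (hM _)))
      simpa [dist_eq_norm] using hL.dist_le_mul z.1 z.2
    rw [hH]
    simp only
    rw [← ofReal_norm, ENNReal.ofReal_rpow_of_nonneg (norm_nonneg _) hp0.le, ← ofReal_norm]
    refine ENNReal.ofReal_le_ofReal (le_trans ?_ (Real.le_norm_self _))
    gcongr
  have hzero : ∀ z : EuclideanSpace ℝ (Fin n) × EuclideanSpace ℝ (Fin n),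
      z.1 ∉ K → z.2 ∉ K → gagliardoQuot s p φ z = 0 := fun z h1 h2 => by
    rw [gagliardoQuot, image_eq_zero_of_notMem_tsupport h1, image_eq_zero_of_notMem_tsupport h2,
      sub_zero, zero_div]
  have hneg : ∀ h, H (-h) = H h := fun h => by simp [hH]
  -- The quotient vanishes unless one of the two points lies in `K`. Each half then integrates to
  -- `|K| ∫ H` by translation invariance; evenness of `H` makes the halves swap images of each
  -- other.
  have hle : ∀ z : EuclideanSpace ℝ (Fin n) × EuclideanSpace ℝ (Fin n),
      ‖gagliardoQuot s p φ z‖ₑ ^ p ≤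
        K.indicator 1 z.1 * H (z.2 - z.1) + K.indicator 1 z.2 * H (z.1 - z.2) := by
    intro z
    by_cases h1 : z.1 ∈ K
    · refine le_add_right ?_
      rw [Set.indicator_of_mem h1, Pi.one_apply, one_mul, ← hneg, neg_sub]
      exact hbound z
    by_cases h2 : z.2 ∈ K
    · refine le_add_left ?_
      rw [Set.indicator_of_mem h2, Pi.one_apply, one_mul]
      exact hbound z
    · rw [hzero z h1 h2, enorm_zero, ENNReal.zero_rpow_of_pos hp0]
      exact zero_le
  have hm1 : Measurable fun z : EuclideanSpace ℝ (Fin n) × EuclideanSpace ℝ (Fin n) =>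
      K.indicator (1 : EuclideanSpace ℝ (Fin n) → ℝ≥0∞) z.1 * H (z.2 - z.1) :=
    ((measurable_one.indicator hKm).comp measurable_fst).mul
      (hHm.comp (measurable_snd.sub measurable_fst))
  have hI1 : ∫⁻ z : EuclideanSpace ℝ (Fin n) × EuclideanSpace ℝ (Fin n),
      K.indicator (1 : EuclideanSpace ℝ (Fin n) → ℝ≥0∞) z.1 * H (z.2 - z.1) =
      volume K * ∫⁻ h, H h := by
    rw [Measure.volume_eq_prod, lintegral_prod _ hm1.aemeasurable]
    have h1 : ∀ x, ∫⁻ y, K.indicator (1 : EuclideanSpace ℝ (Fin n) → ℝ≥0∞) x * H (y - x) =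
        K.indicator 1 x * ∫⁻ h, H h := fun x => by
      rw [← lintegral_sub_right_eq_self H x]
      exact lintegral_const_mul _ (hHm.comp (measurable_id.sub_const x))
    simp only [h1]
    rw [lintegral_mul_const _ (measurable_one.indicator hKm), lintegral_indicator_one hKm]
  have hI2 : ∫⁻ z : EuclideanSpace ℝ (Fin n) × EuclideanSpace ℝ (Fin n),
      K.indicator (1 : EuclideanSpace ℝ (Fin n) → ℝ≥0∞) z.2 * H (z.1 - z.2) =
      volume K * ∫⁻ h, H h := by
    rw [← hI1, Measure.volume_eq_prod]
    exact lintegral_prod_swap (μ := volume) (ν := volume)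
      (fun z : EuclideanSpace ℝ (Fin n) × EuclideanSpace ℝ (Fin n) =>
        K.indicator (1 : EuclideanSpace ℝ (Fin n) → ℝ≥0∞) z.1 * H (z.2 - z.1))
  refine ⟨hqm.aestronglyMeasurable, ?_⟩
  rw [eLpNorm_lt_top_iff_lintegral_rpow_enorm_lt_top (by simpa using hp0) ENNReal.ofReal_ne_top,
    htp]
  refine (lintegral_mono hle).trans_lt ?_
  rw [lintegral_add_left hm1, hI1, hI2]
  exact (ENNReal.add_ne_top.2 ⟨ENNReal.mul_ne_top hKfin hHfin,
    ENNReal.mul_ne_top hKfin hHfin⟩).lt_top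

/-! ### The duality map and the weak form -/

/-- The duality map `t ↦ |t|^(p-2) t`. -/
noncomputable def dualityMap (p t : ℝ) : ℝ := |t| ^ (p - 2) * t

theorem norm_dualityMap {p : ℝ} (hp : 1 < p) (t : ℝ) : ‖dualityMap p t‖ = ‖t‖ ^ (p - 1) := by
  rcases eq_or_ne t 0 with rfl | ht
  · simp [dualityMap, Real.zero_rpow (sub_pos.2 hp).ne']
  · have h0 : 0 < |t| := abs_pos.2 ht
    rw [dualityMap, norm_mul, Real.norm_of_nonneg (by positivity), Real.norm_eq_abs]
    conv_lhs => rw [← Real.rpow_one |t|, ← Real.rpow_mul h0.le, ← Real.rpow_add h0]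
    congr 1
    ring

/-- Only the origin needs care: for `p < 2` the factor `|t|^(p-2)` blows up there, but the absolute
value of the product is `|t|^(p-1)`, which tends to zero. -/
theorem continuous_dualityMap {p : ℝ} (hp : 1 < p) : Continuous (dualityMap p) := by
  rw [continuous_iff_continuousAt]
  intro t
  rcases eq_or_ne t 0 with rfl | ht
  · have h0 : dualityMap p 0 = 0 := by simp [dualityMap]
    rw [ContinuousAt, h0, tendsto_zero_iff_norm_tendsto_zero]
    simp_rw [norm_dualityMap hp]
    have h1 : Continuous fun t : ℝ => ‖t‖ ^ (p - 1) :=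
      continuous_norm.rpow_const fun _ => Or.inr (sub_pos.2 hp).le
    simpa [Real.zero_rpow (sub_pos.2 hp).ne'] using h1.tendsto 0
  · exact (continuousAt_id.abs.rpow_const (Or.inl (abs_ne_zero.2 ht))).mul continuousAt_id

/-- The kernel exponent is `n + sp = (n/p + s)((p - 2) + 1 + 1)`, so the weight distributes over the
three factors. On the diagonal both sides are zero. -/
theorem pLapIntegrand_eq {n : ℕ} {s p : ℝ} (hp : 1 < p) (u v : EuclideanSpace ℝ (Fin n) → ℝ)
    (z : EuclideanSpace ℝ (Fin n) × EuclideanSpace ℝ (Fin n)) :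
    pLapIntegrand s p u v z = dualityMap p (gagliardoQuot s p u z) * gagliardoQuot s p v z := by
  rcases eq_or_ne z.1 z.2 with h | h
  · simp [pLapIntegrand, gagliardoQuot, h]
  · have hd : 0 < ‖z.1 - z.2‖ := norm_pos_iff.2 (sub_ne_zero.2 h)
    have hpow : ‖z.1 - z.2‖ ^ ((n : ℝ) + s * p) =
        (‖z.1 - z.2‖ ^ ((n : ℝ) / p + s)) ^ (p - 2) * ‖z.1 - z.2‖ ^ ((n : ℝ) / p + s) *
          ‖z.1 - z.2‖ ^ ((n : ℝ) / p + s) := by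
      rw [← Real.rpow_mul hd.le, ← Real.rpow_add hd, ← Real.rpow_add hd]
      congr 1
      field_simp
      ring
    rw [pLapIntegrand, dualityMap, gagliardoQuot, gagliardoQuot, hpow, abs_div,
      Real.div_rpow (abs_nonneg _) (abs_nonneg _),
      abs_of_nonneg (Real.rpow_nonneg (norm_nonneg _) _)]
    have hd' : ‖z.1 - z.2‖ ^ ((n : ℝ) / p + s) ≠ 0 := (Real.rpow_pos_of_pos hd _).ne'
    have hd2 : (‖z.1 - z.2‖ ^ ((n : ℝ) / p + s)) ^ (p - 2) ≠ 0 :=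
      (Real.rpow_pos_of_pos (Real.rpow_pos_of_pos hd _) _).ne'
    field_simp

/-- Conjugacy gives `(p-1) q = p`, so bounds on the quotients in `L^p` become bounds on their
duality images in `L^q`. -/
theorem eLpNorm_dualityMap {α : Type*} [MeasurableSpace α] {μ : Measure α} {p q : ℝ}
    (hpq : p.HolderConjugate q) (g : α → ℝ) :
    eLpNorm (fun x => dualityMap p (g x)) (ENNReal.ofReal q) μ =
      eLpNorm g (ENNReal.ofReal p) μ ^ (p - 1) := by
  have h1 : eLpNorm (fun x => dualityMap p (g x)) (ENNReal.ofReal q) μ =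
      eLpNorm (fun x => ‖g x‖ ^ (p - 1)) (ENNReal.ofReal q) μ := by
    refine eLpNorm_congr_norm_ae (ae_of_all _ fun x => ?_)
    rw [norm_dualityMap hpq.lt, Real.norm_of_nonneg (r := ‖g x‖ ^ (p - 1)) (by positivity)]
  rw [h1, eLpNorm_norm_rpow _ hpq.sub_one_pos, ← ENNReal.ofReal_mul hpq.symm.nonneg, mul_comm,
    hpq.sub_one_mul_conj]

theorem memLp_dualityMap {α : Type*} [MeasurableSpace α] {μ : Measure α} {p q : ℝ}
    (hpq : p.HolderConjugate q) {g : α → ℝ} (hg : MemLp g (ENNReal.ofReal p) μ) :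
    MemLp (fun x => dualityMap p (g x)) (ENNReal.ofReal q) μ := by
  refine ⟨(continuous_dualityMap hpq.lt).comp_aestronglyMeasurable hg.1, ?_⟩
  rw [eLpNorm_dualityMap hpq]
  exact ENNReal.rpow_lt_top_of_nonneg hpq.sub_one_pos.le hg.2.ne

theorem integrable_pLapIntegrand {n : ℕ} {s p : ℝ} (hp : 1 < p)
    {u v : EuclideanSpace ℝ (Fin n) → ℝ}
    (hu : MemLp (gagliardoQuot s p u) (ENNReal.ofReal p) volume)
    (hv : MemLp (gagliardoQuot s p v) (ENNReal.ofReal p) volume) :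
    Integrable (pLapIntegrand s p u v) volume := by
  have hpq := Real.HolderConjugate.conjExponent hp
  have := hpq.symm.ennrealOfReal
  rw [funext (pLapIntegrand_eq hp u v)]
  exact (memLp_dualityMap hpq hu).integrable_mul hv

theorem pLapIntegrand_congr_right {n : ℕ} {s p : ℝ} (hp : 1 < p)
    (u : EuclideanSpace ℝ (Fin n) → ℝ) {v w : EuclideanSpace ℝ (Fin n) → ℝ}
    (h : v =ᵐ[volume] w) : pLapIntegrand s p u v =ᵐ[volume] pLapIntegrand s p u w := by
  filter_upwards [gagliardoQuot_congr (s := s) (p := p) h] with z hz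
  rw [pLapIntegrand_eq hp, pLapIntegrand_eq hp, hz]

/-- An exceptional null set `N` in the space only excludes `N × ℝⁿ` and `ℝⁿ × N`, both null in the
product. -/
theorem ae_tendsto_gagliardoQuot {n : ℕ} {s p : ℝ} {u : ℕ → EuclideanSpace ℝ (Fin n) → ℝ}
    {a : EuclideanSpace ℝ (Fin n) → ℝ}
    (h : ∀ᵐ x, Tendsto (fun k => u k x) atTop (𝓝 (a x))) :
    ∀ᵐ z, Tendsto (fun k => gagliardoQuot s p (u k) z) atTop (𝓝 (gagliardoQuot s p a z)) := by
  have h1 := (Measure.quasiMeasurePreserving_fst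
    (μ := (volume : Measure (EuclideanSpace ℝ (Fin n))))
    (ν := (volume : Measure (EuclideanSpace ℝ (Fin n))))).ae h
  have h2 := (Measure.quasiMeasurePreserving_snd
    (μ := (volume : Measure (EuclideanSpace ℝ (Fin n))))
    (ν := (volume : Measure (EuclideanSpace ℝ (Fin n))))).ae h
  rw [← Measure.volume_eq_prod] at h1 h2
  filter_upwards [h1, h2] with z hz1 hz2
  exact (hz1.sub hz2).div_const _

end FracPLap

/-! ### Passage to the limit -/

theorem theorem3p4 {n : ℕ} {s p : ℝ} (hs₀ : 0 < s) (hs₁ : s < 1) [Fact (1 < p)]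
    (D : Set (EuclideanSpace ℝ (Fin n))) (hD : IsOpen D) (hDb : Bornology.IsBounded D)
    (Ωs : ℕ → Set (EuclideanSpace ℝ (Fin n))) (Ω : Set (EuclideanSpace ℝ (Fin n)))
    (hΩs : ∀ k, IsOpen (Ωs k)) (hΩsD : ∀ k, Ωs k ⊆ D) (hΩ : IsOpen Ω) (hΩD : Ω ⊆ D)
    (hconv : Tendsto (fun k => FracPLap.hausdorffComplEDist (closure D) (Ωs k) Ω) atTop (𝓝 0))
    (f : StrongDual ℝ (FracPLap.FracSobolev.zeroOutside s p D))
    (u : ℕ → FracPLap.FracSobolev.zeroOutside s p D)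
    (hu : ∀ k, FracPLap.IsDirichletSolution (Ωs k) f (u k))
    (uStar : FracPLap.FracSobolev.zeroOutside s p D)
    (hweak : Tendsto (fun k => toWeakSpace ℝ _ (u k)) atTop (𝓝 (toWeakSpace ℝ _ uStar)))
    (φ : EuclideanSpace ℝ (Fin n) → ℝ) (hφ : ContDiff ℝ ∞ φ) (hφc : HasCompactSupport φ)
    (hφΩ : tsupport φ ⊆ Ω) :
    -- `φ` defines a class `w` in `W_0^{s,p}(D)`, so that `f` can be applied to it
    ∃ w : FracPLap.FracSobolev.zeroOutside s p D,
      (w : FracPLap.FracSobolev n s p).toLp =ᵐ[volume] φ ∧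
      Integrable
        (FracPLap.pLapIntegrand s p (uStar : FracPLap.FracSobolev n s p).toLp φ) ∧
      ∫ z, FracPLap.pLapIntegrand s p (uStar : FracPLap.FracSobolev n s p).toLp φ z = f w := by
  have hp : 1 < p := Fact.out
  have hpq := Real.HolderConjugate.conjExponent hp
  have hφL : MemLp φ (ENNReal.ofReal p) volume :=
    hφ.continuous.memLp_of_hasCompactSupport hφc
  have hφq := FracPLap.memLp_gagliardoQuot_of_contDiff hs₀ hs₁ hp hφ hφc
  have hweak' : ∀ l : StrongDual ℝ (FracPLap.FracSobolev.zeroOutside s p D),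
      Tendsto (fun k => l (u k)) atTop (𝓝 (l uStar)) := fun l =>
    ((WeakBilin.eval_continuous (topDualPairing ℝ _).flip l).tendsto _).comp hweak
  have hwφ : (hφL.toLp φ : EuclideanSpace ℝ (Fin n) → ℝ) =ᵐ[volume] φ := hφL.coeFn_toLp
  let w₀ : FracPLap.FracSobolev n s p :=
    ⟨hφL.toLp φ, (memLp_congr_ae (FracPLap.gagliardoQuot_congr hwφ)).2 hφq⟩
  have hw₀ : w₀.toLp =ᵐ[volume] φ := hwφ
  have hwS : ∀ S : Set (EuclideanSpace ℝ (Fin n)), tsupport φ ⊆ S →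
      w₀ ∈ FracPLap.FracSobolev.zeroOutside s p S := by
    intro S hS
    change ∀ᵐ x, x ∉ S → w₀.toLp x = 0
    filter_upwards [hw₀] with x hx hxS
    rw [hx]
    exact image_eq_zero_of_notMem_tsupport fun h => hxS (hS h)
  refine ⟨⟨w₀, hwS D (hφΩ.trans hΩD)⟩, hw₀,
    FracPLap.integrable_pLapIntegrand hp (FracPLap.FracSobolev.memLp_gagliardoQuot _) hφq, ?_⟩
  obtain ⟨ns, hns, hae⟩ := FracPLap.FracSobolev.exists_subseq_tendsto_ae hs₀ hD.measurableSet
    hDb.measure_lt_top.ne hweak'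
  obtain ⟨M, hM⟩ := FracPLap.exists_norm_le_of_tendsto_eval hweak'
  have hlim := FracPLap.tendsto_integral_mul (μ := volume) hpq
    (F := fun j z => FracPLap.dualityMap p
      (FracPLap.gagliardoQuot s p (u (ns j) : FracPLap.FracSobolev n s p).toLp z))
    (F₀ := fun z => FracPLap.dualityMap p
      (FracPLap.gagliardoQuot s p (uStar : FracPLap.FracSobolev n s p).toLp z))
    (G := FracPLap.gagliardoQuot s p φ)
    (fun j => FracPLap.memLp_dualityMap hpq (FracPLap.FracSobolev.memLp_gagliardoQuot _))
    (FracPLap.memLp_dualityMap hpq (FracPLap.FracSobolev.memLp_gagliardoQuot _)) hφq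
    (by
      filter_upwards [FracPLap.ae_tendsto_gagliardoQuot (s := s) (p := p) hae] with z hz
      exact ((FracPLap.continuous_dualityMap hp).tendsto _).comp hz)
    (M := ENNReal.ofReal M ^ (p - 1))
    (ENNReal.rpow_ne_top_of_nonneg hpq.sub_one_pos.le ENNReal.ofReal_ne_top)
    (fun j => by
      rw [FracPLap.eLpNorm_dualityMap hpq]
      exact ENNReal.rpow_le_rpow ((FracPLap.FracSobolev.eLpNorm_gagliardoQuot_le _).trans
        (ENNReal.ofReal_le_ofReal (hM _))) hpq.sub_one_pos.le)
  simp_rw [← FracPLap.pLapIntegrand_eq hp] at hlim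
  have hsub := FracPLap.eventually_subset_of_hausdorffCompl isClosed_closure hΩ hconv hφc
    ((hφΩ.trans hΩD).trans subset_closure) hφΩ
  -- Along the subsequence the weak form converges to its value at `uStar`, and it eventually equals
  -- `f w`.
  refine tendsto_nhds_unique hlim (tendsto_const_nhds.congr' ?_)
  filter_upwards [hns.tendsto_atTop.eventually hsub] with j hj
  rw [← (hu (ns j)).2 ⟨w₀, hwS D (hφΩ.trans hΩD)⟩ (hwS _ hj)]
  exact integral_congr_ae (FracPLap.pLapIntegrand_congr_right hp _ hw₀)
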